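/- Let $\mathcal C$ be an abelian category and $Q$ a quiver with vertex set $Q_0$ and arrow set $Q_1$; for an arrow $a$ let $s(a)$ and $t(a)$ be its source and target. For $i\in Q_0$ put $Q_1^{*\to i}=\{a\in Q_1 : t(a)=i\}$ and $Q_1^{i\to *}=\{a\in Q_1 : s(a)=i\}$. Let $\mathrm{Rep}(Q,\mathcal C)$ be the abelian category of $\mathcal C$-valued representations of $Q$, that is, of functors to $\mathcal C$ from the path category of $Q$. For classes of objects $\mathcal A,\mathcal B$ of an abelian category, let $\mathcal A^\perp=\{X : \mathrm{Ext}^1(A,X)=0 \text{ for all } A\in\mathcal A\}$ and ${}^\perp\mathcal B=\{X : \mathrm{Ext}^1(X,B)=0 \text{ for all } B\in\mathcal B\}$. The pair $(\mathcal A,\mathcal B)$ is a cotorsion pair if $\mathcal A^\perp=\mathcal B$ and ${}^\perp\mathcal B=\mathcal A$. It is complete if moreover for every object $X$ there are short exact sequences $0\to B\to A\to X\to 0$ and $0\to X\to B'\to A'\to 0$ with $A,A'\in\mathcal A$ and $B,B'\in\mathcal B$. It is hereditary if $\mathrm{Ext}^n(A,B)=0$ for all $n\ge 1$, $A\in\mathcal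 A$, $B\in\mathcal B$. Define $V_0=\emptyset$, $V_{\alpha+1}=\{i\in Q_0 : i \text{ is not the target of any arrow } a \text{ with } s(a)\in Q_0\setminus\bigcup_{\gamma\le\alpha}V_\gamma\}$ for every ordinal $\alpha$, and $V_\beta=\bigcup_{\gamma<\beta}V_\gamma$ for every limit ordinal $\beta$. The quiver $Q$ is left rooted if $V_\lambda=Q_0$ for some ordinal $\lambda$, and right rooted if the opposite quiver $Q^{\mathrm{op}}$ is left rooted. For a class $\mathcal F$ of objects of $\mathcal C$, when the relevant coproducts (respectively products) exist, let $\Phi(\mathcal F)$ be the class of representations $X$ such that for every $i\in Q_0$ the canonical morphism $\varphi_i^X:\bigoplus_{a\in Q_1^{*\to i}}X(s(a))\to X(i)$ is a monomorphism with cokernel in $\mathcal F$. Respectively, let $\Psi(\mathcal F)$ be the class of representations $X$ such that for every $i\in Q_0$ the canonical morphism $\psi_i^X:X(i)\to\prod_{a\in Q_1^{i\to *}}X(t(a))$ is an epimorphism with kernel in $\mathcal F$. Theorem. Let $(\mathcal A,\mathcal B)$ be a complete hereditary cotorsion pair in $\mathcal C$. (1) If $Q$ is left rooted and, for every vertex $i$,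 $\mathcal C$ has exact coproducts indexed by $Q_1^{*\to i}$, then $(\Phi(\mathcal A),\Phi(\mathcal A)^\perp)$ is a complete cotorsion pair in $\mathrm{Rep}(Q,\mathcal C)$. (2) If $Q$ is right rooted and, for every vertex $i$, $\mathcal C$ has exact products indexed by $Q_1^{i\to *}$, then $({}^\perp\Psi(\mathcal B),\Psi(\mathcal B))$ is a complete cotorsion pair in $\mathrm{Rep}(Q,\mathcal C)$. -/

import Mathlib

open CategoryTheory CategoryTheory.Limits

universe v u v' u'

noncomputable section

namespace QuiverCotorsion

/-! ### Cotorsion pairs in an abelian category -/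

section Cotorsion

variable {C : Type u} [Category.{v} C] [Abelian C]

/-- `Ext^n(X, Y) = 0`. The `Ext`-groups of an arbitrary abelian category always exist in a large
enough universe, so no smallness assumption on the category is needed. -/
def ExtVanishes (X Y : C) (n : ℕ) : Prop :=
  letI : HasExt.{max u v} C := HasExt.standard C
  Subsingleton (Abelian.Ext.{max u v} X Y n)

/-- The class `𝓐^⊥` of all objects `X` with `Ext^1(A, X) = 0` for all `A` in `𝓐`. -/
def rightPerp (A : ObjectProperty C) : ObjectProperty C :=
  fun X => ∀ Y : C, A Y → ExtVanishes Y X 1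

/-- The class `^⊥𝓑` of all objects `X` with `Ext^1(X, B) = 0` for all `B` in `𝓑`. -/
def leftPerp (B : ObjectProperty C) : ObjectProperty C :=
  fun X => ∀ Y : C, B Y → ExtVanishes X Y 1

/-- `(𝓐, 𝓑)` is a cotorsion pair: `𝓐^⊥ = 𝓑` and `^⊥𝓑 = 𝓐`. -/
structure IsCotorsionPair (A B : ObjectProperty C) : Prop where
  rightPerp_eq : rightPerp A = B
  leftPerp_eq : leftPerp B = A

/-- There is a short exact sequence `0 → B → A → X → 0` with `A` in `𝓐` and `B` in `𝓑`. -/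
def HasSpecialPrecover (A B : ObjectProperty C) (X : C) : Prop :=
  ∃ (K P : C) (i : K ⟶ P) (p : P ⟶ X) (w : i ≫ p = 0),
    A P ∧ B K ∧ (ShortComplex.mk i p w).ShortExact

/-- There is a short exact sequence `0 → X → B → A → 0` with `A` in `𝓐` and `B` in `𝓑`. -/
def HasSpecialPreenvelope (A B : ObjectProperty C) (X : C) : Prop :=
  ∃ (E L : C) (i : X ⟶ E) (p : E ⟶ L) (w : i ≫ p = 0),
    A L ∧ B E ∧ (ShortComplex.mk i p w).ShortExact

/-- `(𝓐, 𝓑)` is a complete cotorsion pair: it is a cotorsion pair with enough projectives (special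
precovers) and enough injectives (special preenvelopes). -/
structure IsCompleteCotorsionPair (A B : ObjectProperty C) : Prop extends
    IsCotorsionPair A B where
  enoughProjectives : ∀ X : C, HasSpecialPrecover A B X
  enoughInjectives : ∀ X : C, HasSpecialPreenvelope A B X

/-- `(𝓐, 𝓑)` is hereditary: `Ext^n(A, B) = 0` for all `n ≥ 1`, `A` in `𝓐` and `B` in `𝓑`. -/
def IsHereditary (A B : ObjectProperty C) : Prop :=
  ∀ n : ℕ, 1 ≤ n → ∀ X Y : C, A X → B Y → ExtVanishes X Y n

end Cotorsion

/-! ### Rooted quivers -/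

section Rooted

/-- The transfinite sequence `V_α` of sets of vertices of a quiver; see `rootedSet_zero`,
`rootedSet_succ` and `rootedSet_limit` for the usual recursive description. -/
def rootedSet (Q : Type u') [Quiver.{v'} Q] (α : Ordinal.{u'}) : Set Q :=
  {i | ∃ β, ∃ _ : β < α, ∀ j : Q, (j ⟶ i) → ∃ γ, ∃ _ : γ ≤ β, j ∈ rootedSet Q γ}
termination_by α
decreasing_by exact lt_of_le_of_lt ‹_› ‹_›

variable (Q : Type u') [Quiver.{v'} Q]

theorem mem_rootedSet {α : Ordinal.{u'}} {i : Q} :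
    i ∈ rootedSet Q α ↔
      ∃ β, β < α ∧ ∀ j : Q, (j ⟶ i) → ∃ γ, γ ≤ β ∧ j ∈ rootedSet Q γ := by
  rw [rootedSet]
  simp only [Set.mem_ofPred_eq, exists_prop]

/-- `V_0 = ∅`. -/
theorem rootedSet_zero : rootedSet Q 0 = ∅ := by
  ext i
  rw [mem_rootedSet]
  simp

/-- `V_{α+1}` consists of the vertices which are not the target of any arrow whose source lies
outside `⋃_{γ ≤ α} V_γ`. -/
theorem rootedSet_succ (α : Ordinal.{u'}) :
    rootedSet Q (Order.succ α) =
      {i | ¬ ∃ j : Q, Nonempty (j ⟶ i) ∧ j ∉ ⋃ γ ∈ Set.Iic α, rootedSet Q γ} := by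
  ext i
  rw [mem_rootedSet]
  simp only [Order.lt_succ_iff, Set.mem_ofPred_eq, Set.mem_iUnion, Set.mem_Iic, exists_prop]
  constructor
  · rintro ⟨β, hβ, h⟩ ⟨j, ⟨a⟩, hj⟩
    obtain ⟨γ, hγ, hj'⟩ := h j a
    exact hj ⟨γ, hγ.trans hβ, hj'⟩
  · intro h
    exact ⟨α, le_rfl, fun j a => by_contra fun hj => h ⟨j, ⟨a⟩, hj⟩⟩

/-- `V_β = ⋃_{γ < β} V_γ` for a limit ordinal `β`. -/
theorem rootedSet_limit {β : Ordinal.{u'}} (hβ : Order.IsSuccLimit β) :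
    rootedSet Q β = ⋃ γ ∈ Set.Iio β, rootedSet Q γ := by
  ext i
  simp only [Set.mem_iUnion, Set.mem_Iio, exists_prop]
  constructor
  · intro hi
    obtain ⟨δ, hδ, h⟩ := (mem_rootedSet Q).1 hi
    exact ⟨Order.succ δ, hβ.succ_lt hδ, (mem_rootedSet Q).2 ⟨δ, Order.lt_succ δ, h⟩⟩
  · rintro ⟨γ, hγ, hi⟩
    obtain ⟨δ, hδ, h⟩ := (mem_rootedSet Q).1 hi
    exact (mem_rootedSet Q).2 ⟨δ, hδ.trans hγ, h⟩

/-- A quiver is left rooted if `V_λ` is the set of all vertices for some ordinal `λ`. -/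
def IsLeftRooted : Prop :=
  ∃ α : Ordinal.{u'}, rootedSet Q α = Set.univ

/-- A quiver is right rooted if the opposite quiver is left rooted. -/
def IsRightRooted : Prop :=
  IsLeftRooted Qᵒᵖ

end Rooted

/-! ### Representations of a quiver -/

section Representations

/-- The category of `C`-valued representations of the quiver `Q`: functors to `C` from the category
with objects the vertices and with morphisms the paths of `Q`. -/
abbrev QRep (Q : Type u') [Quiver.{v'} Q] (C : Type u) [Category.{v} C] :=
  Paths Q ⥤ C

variable {Q : Type u'} [Quiver.{v'} Q]

/-- The set `Q_1^{* → i}` of arrows with target `i`. -/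
abbrev ArrowsInto (i : Q) := Σ j : Q, (j ⟶ i)

/-- The set `Q_1^{i → *}` of arrows with source `i`. -/
abbrev ArrowsOutOf (i : Q) := Σ j : Q, (i ⟶ j)

variable {C : Type u} [Category.{v} C]

/-- The object of a representation at a vertex. -/
abbrev repObj (X : QRep Q C) (i : Q) : C :=
  X.obj ((Paths.of Q).obj i)

/-- The morphism of a representation at an arrow. -/
abbrev repMap (X : QRep Q C) {i j : Q} (a : i ⟶ j) : repObj X i ⟶ repObj X j :=
  X.map ((Paths.of Q).map a)

/-- The canonical morphism `φ_i^X : ⨁_{a : * → i} X(s(a)) ⟶ X(i)`. -/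
def phiMap (X : QRep Q C) (i : Q) [HasCoproductsOfShape (ArrowsInto i) C] :
    (∐ fun a : ArrowsInto i => repObj X a.1) ⟶ repObj X i :=
  Sigma.desc fun a : ArrowsInto i => repMap X a.2

/-- The canonical morphism `ψ_i^X : X(i) ⟶ ∏_{a : i → *} X(t(a))`. -/
def psiMap (X : QRep Q C) (i : Q) [HasProductsOfShape (ArrowsOutOf i) C] :
    repObj X i ⟶ ∏ᶜ fun a : ArrowsOutOf i => repObj X a.1 :=
  Pi.lift fun a : ArrowsOutOf i => repMap X a.2

variable [Abelian C]

/-- The class `Φ(𝓕)` of all representations `X` such that, for every vertex `i`, the morphism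
`φ_i^X` is monic and its cokernel is in `𝓕`. -/
def Phi (Q : Type u') [Quiver.{v'} Q] [∀ i : Q, HasCoproductsOfShape (ArrowsInto i) C]
    (F : ObjectProperty C) : ObjectProperty (QRep Q C) :=
  fun X => ∀ i : Q, Mono (phiMap X i) ∧ F (cokernel (phiMap X i))

/-- The class `Ψ(𝓕)` of all representations `X` such that, for every vertex `i`, the morphism
`ψ_i^X` is epic and its kernel is in `𝓕`. -/
def Psi (Q : Type u') [Quiver.{v'} Q] [∀ i : Q, HasProductsOfShape (ArrowsOutOf i) C]
    (F : ObjectProperty C) : ObjectProperty (QRep Q C) :=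
  fun X => ∀ i : Q, Epi (psiMap X i) ∧ F (kernel (psiMap X i))

end Representations

end QuiverCotorsion

end

/-! For left rooted `Q`, the class Φ(𝓐)^⊥ is the class of representations with every value in 𝓑.
Each construction is a well-founded recursion along the arrows: the data at the sources of the
arrows into `i` are available before the data at `i`.

Ext^1 vanishes between the two classes because partial sections extend. Sections at the sources
prescribe one on ⨁ X(s(a)), and it extends along the monomorphism φ_i^X, whose cokernel is in 𝓐,
since the kernel of the extension at `i` is in 𝓑 (`exists_section_extending`). Special precovers
come from factoring ⨁ P(s(a)) ⟶ X(i) (`IsCompleteCotorsionPair.exists_factorization`). Special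
preenvelopes come from embedding into 𝓑 the pushout that glues X(i) to the values already built
(`phi_of_shortExact`). A retract argument (`IsCompleteCotorsionPair.mk'`) turns these facts into a
complete cotorsion pair.

The right rooted case is the left rooted one for the opposite quiver, the opposite category and the
pair (𝓑ᵒᵖ, 𝓐ᵒᵖ), transported along Rep(Q, C)ᵒᵖ ≌ Rep(Qᵒᵖ, Cᵒᵖ). -/

noncomputable section

namespace QuiverCotorsion

/-! ### Ext^1 and split extensions. -/

section Splitting

open Pretriangulated

variable {C : Type u} [Category.{v} C] [Abelian C]

/-- Every class in `Hom(X, Y[1])` in the derived category is the connecting morphism of a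
distinguished triangle coming from a short exact sequence. -/
lemma exists_shortExact_distinguished [HasDerivedCategory C] {X Y : C}
    (α : (DerivedCategory.singleFunctor C 0).obj X ⟶
      ((DerivedCategory.singleFunctor C 0).obj Y)⟦(1 : ℤ)⟧) :
    ∃ (E : C) (i : Y ⟶ E) (p : E ⟶ X) (w : i ≫ p = 0), (ShortComplex.mk i p w).ShortExact ∧
      Triangle.mk ((DerivedCategory.singleFunctor C 0).map i)
        ((DerivedCategory.singleFunctor C 0).map p) α ∈ distTriang (DerivedCategory C) := by
  let ι := DerivedCategory.singleFunctor C 0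
  let t := DerivedCategory.TStructure.t (C := C)
  obtain ⟨M, f, g, hT⟩ := distinguished_cocone_triangle₂ α
  -- `M` is an extension of two objects of the heart of the standard t-structure, hence itself in
  -- the heart.
  have hLE : t.IsLE M 0 := t.isLE₂ _ hT 0 (inferInstanceAs ((ι.obj Y).IsLE 0))
    (inferInstanceAs ((ι.obj X).IsLE 0))
  have hGE : t.IsGE M 0 := t.isGE₂ _ hT 0 (inferInstanceAs ((ι.obj Y).IsGE 0))
    (inferInstanceAs ((ι.obj X).IsGE 0))
  obtain ⟨E, ⟨e⟩⟩ := DerivedCategory.exists_iso_singleFunctor_obj_of_isGE_of_isLE M 0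
  obtain ⟨i, hi⟩ := ι.map_surjective (f ≫ e.hom)
  obtain ⟨p, hp⟩ := ι.map_surjective (e.inv ≫ g)
  have hT' : Triangle.mk (ι.map i) (ι.map p) α ∈ distTriang (DerivedCategory C) :=
    isomorphic_distinguished _ hT _
      (Triangle.isoMk _ _ (Iso.refl (ι.obj Y)) e.symm (Iso.refl (ι.obj X))
        (show ι.map i ≫ e.inv = 𝟙 (ι.obj Y) ≫ f by simp [hi])
        (show ι.map p ≫ 𝟙 (ι.obj X) = e.inv ≫ g by simp [hp])
        (show α ≫ (𝟙 (ι.obj Y))⟦(1 : ℤ)⟧' = 𝟙 (ι.obj X) ≫ α by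
          rw [CategoryTheory.Functor.map_id, Category.comp_id, Category.id_comp]))
  -- Objects of the heart have no nonzero morphisms of negative degree; this makes the first two
  -- maps of the triangle a kernel and a cokernel.
  have hι : ∀ ⦃A B : C⦄ ⦃n : ℤ⦄ (φ : ι.obj A ⟶ (ι.obj B)⟦n⟧), n < 0 → φ = 0 := by
    intro A B n φ hn
    have := t.isGE_shift (ι.obj B) 0 n (-n)
    exact t.zero φ 0 (-n)
  have hk := Triangulated.AbelianSubcategory.isLimitKernelForkOfDistTriang hι _ _ _ hT'
  have hc := Triangulated.AbelianSubcategory.isColimitCokernelCoforkOfDistTriang hι _ _ _ hT'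
  have w : i ≫ p = 0 := ι.map_injective (by
    rw [Functor.map_comp, Functor.map_zero]
    exact comp_distTriang_mor_zero₁₂ _ hT')
  exact ⟨E, _, _, w,
    { exact := ShortComplex.exact_of_f_is_kernel _ hk
      mono_f := Fork.IsLimit.mono hk
      epi_g := Cofork.IsColimit.epi hc }, hT'⟩

/-- `Ext^1(X, Y) = 0` if and only if every extension of `X` by `Y` splits. -/
lemma extVanishes_one_iff (X Y : C) :
    ExtVanishes X Y 1 ↔ ∀ (E : C) (i : Y ⟶ E) (p : E ⟶ X) (w : i ≫ p = 0),
      (ShortComplex.mk i p w).ShortExact → ∃ s : X ⟶ E, s ≫ p = 𝟙 X := by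
  let : HasExt.{max u v} C := HasExt.standard C
  let := HasDerivedCategory.standard C
  constructor
  · intro h E i p w hS
    have : Subsingleton (Abelian.Ext.{max u v} X Y 1) := h
    -- The obstruction to lifting the identity of `X` along `p` lies in Ext^1(X, Y).
    obtain ⟨s, hs⟩ := Abelian.Ext.covariant_sequence_exact₃ X hS
      (Abelian.Ext.mk₀ (𝟙 X)) (zero_add 1) (Subsingleton.elim (α := Abelian.Ext X Y 1) _ _)
    obtain ⟨s, rfl⟩ := (Abelian.Ext.mk₀_bijective _ _).2 s
    exact ⟨s, (Abelian.Ext.mk₀_bijective _ _).1 (by simpa using hs)⟩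
  · intro h
    refine ⟨fun α β => ?_⟩
    suffices ∀ γ : Abelian.Ext.{max u v} X Y 1, γ.hom = 0 by
      ext
      rw [this α, this β]
    intro γ
    obtain ⟨E, i, p, w, hS, hT⟩ := exists_shortExact_distinguished γ.hom
    obtain ⟨s, hs⟩ := h E i p w hS
    have h0 : (DerivedCategory.singleFunctor C 0).map p ≫ γ.hom = 0 := comp_distTriang_mor_zero₂₃ _ hT
    calc γ.hom = (DerivedCategory.singleFunctor C 0).map (s ≫ p) ≫ γ.hom := by simp [hs]
      _ = 0 := by rw [Functor.map_comp, Category.assoc, h0, comp_zero]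

/-- `Ext^1(X, Y) = 0` if and only if every extension of `X` by `Y` admits a retraction. -/
lemma extVanishes_one_iff_retraction (X Y : C) :
    ExtVanishes X Y 1 ↔ ∀ (E : C) (i : Y ⟶ E) (p : E ⟶ X) (w : i ≫ p = 0),
      (ShortComplex.mk i p w).ShortExact → ∃ r : E ⟶ Y, i ≫ r = 𝟙 Y := by
  rw [extVanishes_one_iff]
  refine forall₅_congr fun E i p w hS => ⟨?_, ?_⟩
  · rintro ⟨s, hs⟩
    exact ⟨_, (ShortComplex.Splitting.ofExactOfSection _ hS.exact s hs hS.mono_f).f_r⟩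
  · rintro ⟨r, hr⟩
    exact ⟨_, (ShortComplex.Splitting.ofExactOfRetraction _ hS.exact r hr hS.epi_g).s_g⟩

end Splitting

/-! ### Short exact sequences and pushouts. -/

section Pushout

variable {C : Type u} [Category.{v} C] [Abelian C]

/-- Since `p` is epi, factorisations through it are unique, so their existence alone makes `p` a
cokernel of `i`. -/
lemma shortExact_of_epi_of_factors {X Y Z : C} {i : X ⟶ Y} {p : Y ⟶ Z} (w : i ≫ p = 0) [Mono i]
    [Epi p] (h : ∀ {T : C} (k : Y ⟶ T), i ≫ k = 0 → ∃ l : Z ⟶ T, p ≫ l = k) :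
    (ShortComplex.mk i p w).ShortExact where
  exact := ShortComplex.exact_of_g_is_cokernel _
    (CokernelCofork.IsColimit.ofπ' p w fun k hk => ⟨(h k hk).choose, (h k hk).choose_spec⟩)
  mono_f := ‹_›
  epi_g := ‹_›

lemma exists_desc_of_shortExact {X Y Z T : C} {i : X ⟶ Y} {p : Y ⟶ Z} {w : i ≫ p = 0}
    (hS : (ShortComplex.mk i p w).ShortExact) (k : Y ⟶ T) (hk : i ≫ k = 0) :
    ∃ l : Z ⟶ T, p ≫ l = k :=
  have := hS.epi_g
  ⟨hS.exact.desc k hk, hS.exact.g_desc k hk⟩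

/-- The pushout of a short exact sequence along a morphism out of its first object. -/
lemma shortExact_pushout {X Y Z X' Y' : C} {i : X ⟶ Y} {p : Y ⟶ Z} {w : i ≫ p = 0}
    (hS : (ShortComplex.mk i p w).ShortExact) {f : X ⟶ X'} {g : Y ⟶ Y'} {i' : X' ⟶ Y'}
    (h : IsPushout i f g i') {p' : Y' ⟶ Z} (hg : g ≫ p' = p) (w' : i' ≫ p' = 0) :
    (ShortComplex.mk i' p' w').ShortExact := by
  have : Mono i := hS.mono_f
  have : Epi p := hS.epi_g
  have : Mono i' := MorphismProperty.of_isPushout (P := .monomorphisms C) h.flip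
    (.infer_property i)
  have : Epi p' := by
    have : Epi (g ≫ p') := hg ▸ ‹Epi p›
    exact epi_of_epi g p'
  refine shortExact_of_epi_of_factors w' fun k hk => ?_
  obtain ⟨l, hl⟩ := exists_desc_of_shortExact hS (g ≫ k) (by rw [h.w_assoc, hk, comp_zero])
  exact ⟨l, h.hom_ext (by rw [reassoc_of% hg, hl]) (by rw [reassoc_of% w', zero_comp, hk])⟩

/-- The pushout of the quotient map of a short exact sequence along a monomorphism. -/
lemma shortExact_comp_of_isPushout {X Y Z Y' Z' : C} {i : X ⟶ Y} {p : Y ⟶ Z} {w : i ≫ p = 0}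
    (hS : (ShortComplex.mk i p w).ShortExact) {f : Y ⟶ Y'} [Mono f] {p' : Y' ⟶ Z'} {g : Z ⟶ Z'}
    (h : IsPushout f p p' g) :
    (ShortComplex.mk (i ≫ f) p' (by rw [Category.assoc, h.w, reassoc_of% w, zero_comp]) :
      ShortComplex C).ShortExact := by
  have : Mono i := hS.mono_f
  have : Epi p := hS.epi_g
  have : Epi p' := h.epi_inl_of_epi
  refine shortExact_of_epi_of_factors _ fun k hk => ?_
  obtain ⟨l, hl⟩ := exists_desc_of_shortExact hS (f ≫ k) (by rw [← Category.assoc, hk])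
  exact ⟨h.desc k l hl.symm, h.inl_desc _ _ _⟩

/-- If `i` and `j` are composable monomorphisms, then the cokernel of `i ≫ j` is an extension of
the cokernel of `j` by the cokernel of `i`. -/
lemma exists_shortExact_comp {X Y Z L M : C} {i : X ⟶ Y} {p : Y ⟶ L} {w : i ≫ p = 0}
    (hS : (ShortComplex.mk i p w).ShortExact) {j : Y ⟶ Z} {q : Z ⟶ M} {w' : j ≫ q = 0}
    (hS' : (ShortComplex.mk j q w').ShortExact) :
    ∃ (N : C) (r : Z ⟶ N) (hr : (i ≫ j) ≫ r = 0) (a : L ⟶ N) (b : N ⟶ M) (hab : a ≫ b = 0),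
      (ShortComplex.mk (i ≫ j) r hr).ShortExact ∧ (ShortComplex.mk a b hab).ShortExact ∧
        j ≫ r = p ≫ a ∧ r ≫ b = q := by
  have : Mono j := hS'.mono_f
  -- `N` is the pushout of `j` and `p`; its two legs give the two sequences.
  have h := IsPushout.of_hasPushout j p
  exact ⟨_, _, _, _, h.desc q 0 (by rw [w', comp_zero]), h.inr_desc _ _ _,
    shortExact_comp_of_isPushout hS h, shortExact_pushout hS' h (h.inl_desc _ _ _) _, h.w,
    h.inl_desc _ _ _⟩

lemma nonempty_cokernel_iso_of_shortExact {X Y Z : C} {i : X ⟶ Y} {p : Y ⟶ Z} {w : i ≫ p = 0}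
    (hS : (ShortComplex.mk i p w).ShortExact) : Nonempty (Z ≅ cokernel i) :=
  have := hS.epi_g
  ⟨hS.exact.gIsCokernel.coconePointUniqueUpToIso (colimit.isColimit _)⟩

lemma nonempty_kernel_iso_of_shortExact {X Y Z : C} {i : X ⟶ Y} {p : Y ⟶ Z} {w : i ≫ p = 0}
    (hS : (ShortComplex.mk i p w).ShortExact) : Nonempty (X ≅ kernel p) :=
  have := hS.mono_f
  ⟨hS.exact.fIsKernel.conePointUniqueUpToIso (limit.isLimit _)⟩

lemma shortExact_cokernel {X Y : C} (f : X ⟶ Y) [Mono f] :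
    (ShortComplex.mk f (cokernel.π f) (cokernel.condition f)).ShortExact where
  exact := ShortComplex.exact_of_g_is_cokernel _ (cokernelIsCokernel f)
  mono_f := ‹_›
  epi_g := inferInstanceAs (Epi (cokernel.π f))

lemma shortExact_kernel {X Y : C} (f : X ⟶ Y) [Epi f] :
    (ShortComplex.mk (kernel.ι f) f (kernel.condition f)).ShortExact where
  exact := ShortComplex.exact_of_f_is_kernel _ (kernelIsKernel f)
  mono_f := inferInstanceAs (Mono (kernel.ι f))
  epi_g := ‹_›

end Pushout

/-! ### Complete cotorsion pairs: retract criterion and factorisations. -/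

section CotorsionPair

variable {C : Type u} [Category.{v} C] [Abelian C]

/-- A class is recovered from its image in Ext^n(X', Y'), since both retractions compose to
identities. -/
lemma ExtVanishes.of_retract {X X' Y Y' : C} {n : ℕ} (r : Retract X X') (s : Retract Y Y')
    (h : ExtVanishes X' Y' n) : ExtVanishes X Y n := by
  let : HasExt.{max u v} C := HasExt.standard C
  have : Subsingleton (Abelian.Ext.{max u v} X' Y' n) := h
  refine ⟨fun α β => ?_⟩
  suffices ∀ γ : Abelian.Ext.{max u v} X Y n, γ = (Abelian.Ext.mk₀ r.i).comp
      ((((Abelian.Ext.mk₀ r.r).comp γ (zero_add n)).comp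
        (Abelian.Ext.mk₀ s.i) (add_zero n)).comp (Abelian.Ext.mk₀ s.r) (add_zero n))
        (zero_add n) by
    rw [this α, this β]
    congr 2
    exact Subsingleton.elim _ _
  intro γ
  simp

lemma ExtVanishes.of_shortExact_left {S : ShortComplex C} (hS : S.ShortExact) {Y : C} {n : ℕ}
    (h₁ : ExtVanishes S.X₁ Y n) (h₃ : ExtVanishes S.X₃ Y n) : ExtVanishes S.X₂ Y n := by
  let : HasExt.{max u v} C := HasExt.standard C
  have h₁ : Subsingleton (Abelian.Ext.{max u v} S.X₁ Y n) := h₁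
  have h₃ : Subsingleton (Abelian.Ext.{max u v} S.X₃ Y n) := h₃
  suffices ∀ γ : Abelian.Ext.{max u v} S.X₂ Y n, γ = 0 from ⟨fun α β => by rw [this α, this β]⟩
  intro γ
  obtain ⟨δ, rfl⟩ := Abelian.Ext.contravariant_sequence_exact₂ hS Y γ (Subsingleton.elim _ _)
  rw [Subsingleton.elim δ 0, Abelian.Ext.comp_zero]

instance (B : ObjectProperty C) : (leftPerp B).IsStableUnderRetracts where
  of_retract r h Y hY := (h Y hY).of_retract r (.refl Y)

instance (A : ObjectProperty C) : (rightPerp A).IsStableUnderRetracts where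
  of_retract r h Y hY := (h Y hY).of_retract (.refl Y) r

namespace IsCotorsionPair

variable {A B : ObjectProperty C} (h : IsCotorsionPair A B)
include h

lemma isStableUnderRetracts_left : A.IsStableUnderRetracts := by
  rw [← h.leftPerp_eq]
  infer_instance

lemma isStableUnderRetracts_right : B.IsStableUnderRetracts := by
  rw [← h.rightPerp_eq]
  infer_instance

lemma extVanishes {X Y : C} (hX : A X) (hY : B Y) : ExtVanishes X Y 1 := by
  rw [← h.leftPerp_eq] at hX
  exact hX Y hY

lemma prop_of_shortExact {S : ShortComplex C} (hS : S.ShortExact) (h₁ : A S.X₁) (h₃ : A S.X₃) :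
    A S.X₂ := by
  rw [← h.leftPerp_eq] at h₁ h₃ ⊢
  exact fun Y hY => (h₁ Y hY).of_shortExact_left hS (h₃ Y hY)

end IsCotorsionPair

/-- Two classes stable under retracts, with vanishing `Ext^1` between them and with both kinds of
approximation sequences, form a complete cotorsion pair. -/
lemma IsCompleteCotorsionPair.mk' {A B : ObjectProperty C} [A.IsStableUnderRetracts]
    [B.IsStableUnderRetracts] (hext : ∀ X Y : C, A X → B Y → ExtVanishes X Y 1)
    (hp : ∀ X : C, HasSpecialPrecover A B X) (hi : ∀ X : C, HasSpecialPreenvelope A B X) :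
    IsCompleteCotorsionPair A B where
  enoughProjectives := hp
  enoughInjectives := hi
  rightPerp_eq := by
    ext Y
    refine ⟨fun hY => ?_, fun hY X hX => hext X Y hX hY⟩
    -- The special preenvelope of `Y` splits, which makes `Y` a retract of an object of 𝓑; dually
    -- below.
    obtain ⟨E, L, i, p, w, hL, hE, hS⟩ := hi Y
    obtain ⟨r, hr⟩ := (extVanishes_one_iff_retraction L Y).1 (hY L hL) E i p w hS
    exact B.prop_of_retract ⟨i, r, hr⟩ hE
  leftPerp_eq := by
    ext X
    refine ⟨fun hX => ?_, fun hX Y hY => hext X Y hX hY⟩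
    obtain ⟨K, P, i, p, w, hP, hK, hS⟩ := hp X
    obtain ⟨s, hs⟩ := (extVanishes_one_iff X K).1 (hX K hK) P i p w hS
    exact A.prop_of_retract ⟨s, p, hs⟩ hP

/-- A complete cotorsion pair factors every morphism as a monomorphism with cokernel in the left
class followed by an epimorphism with kernel in the right class. -/
lemma IsCompleteCotorsionPair.exists_factorization {A B : ObjectProperty C}
    (h : IsCompleteCotorsionPair A B) {U X : C} (f : U ⟶ X) :
    ∃ (P : C) (u : U ⟶ P) (p : P ⟶ X), u ≫ p = f ∧ Mono u ∧ A (cokernel u) ∧ Epi p ∧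
      B (kernel p) := by
  have := h.isStableUnderRetracts_left
  have := h.isStableUnderRetracts_right
  obtain ⟨K, A₀, i₀, p₀, w₀, hA₀, -, hS₀⟩ := h.enoughProjectives X
  have : Epi p₀ := hS₀.epi_g
  -- Adding `A₀` makes `f` epi. Pushing out along an embedding of `kernel q` into `B₁` replaces the
  -- kernel by `B₁`, and the cokernel of `U` in the pushout is an extension of `A₁` by `A₀`.
  let q : U ⊞ A₀ ⟶ X := biprod.desc f p₀
  have : Epi q := epi_of_epi_fac (biprod.inr_desc f p₀)
  obtain ⟨B₁, A₁, j, c, w₁, hA₁, hB₁, hS₁⟩ := h.enoughInjectives (kernel q)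
  have sq := IsPushout.of_hasPushout (kernel.ι q) j
  have hp := shortExact_pushout (shortExact_kernel q) sq
    (sq.inl_desc q 0 (by simp)) (sq.inr_desc _ _ _)
  have hu := shortExact_pushout hS₁ sq.flip (sq.inr_desc 0 c (by simp [w₁])) (sq.inl_desc _ _ _)
  have hU : (ShortComplex.mk (biprod.inl : U ⟶ U ⊞ A₀) biprod.snd biprod.inl_snd).ShortExact :=
    (ShortComplex.Splitting.mk biprod.fst biprod.inr : ShortComplex.Splitting _).shortExact
  obtain ⟨N, r, hr, a, b, hab, hN, hN', -, -⟩ := exists_shortExact_comp hU hu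
  refine ⟨_, _, sq.desc q 0 (by simp), ?_, hN.mono_f, ?_, hp.epi_g, ?_⟩
  · simp [q]
  · exact A.prop_of_iso (nonempty_cokernel_iso_of_shortExact hN).some (h.prop_of_shortExact hN' hA₀ hA₁)
  · exact B.prop_of_iso (nonempty_kernel_iso_of_shortExact hp).some hB₁

end CotorsionPair

/-! ### Recursion along the arrows of a left rooted quiver. -/

section RootedChoice

variable {Q : Type u'} [Quiver.{v'} Q]

/-- Induction on the ordinal: arrows into a vertex of V_α start in some V_γ with γ < α. -/
lemma IsLeftRooted.wellFounded (h : IsLeftRooted Q) :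
    WellFounded fun j i : Q => Nonempty (j ⟶ i) := by
  obtain ⟨α, hα⟩ := h
  suffices ∀ (α : Ordinal.{u'}) (i : Q), i ∈ rootedSet Q α →
      Acc (fun j i : Q => Nonempty (j ⟶ i)) i from ⟨fun i => this α i (hα ▸ Set.mem_univ i)⟩
  intro α
  induction α using WellFoundedLT.induction with
  | ind α ih =>
    intro i hi
    obtain ⟨β, hβ, hj⟩ := (mem_rootedSet Q).1 hi
    refine ⟨_, fun j ⟨a⟩ => ?_⟩
    obtain ⟨γ, hγ, hjγ⟩ := hj j a
    exact ih γ (hγ.trans_lt hβ) j hjγ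

/-- Dependent choice along the arrows of a left rooted quiver. -/
lemma IsLeftRooted.exists_choice (hQ : IsLeftRooted Q) {T : Q → Type*}
    (R : ∀ i : Q, (∀ a : ArrowsInto i, T a.1) → T i → Prop) (h : ∀ i t, ∃ s, R i t s) :
    ∃ t : ∀ i, T i, ∀ i, R i (fun a => t a.1) (t i) := by
  choose f hf using h
  let t : ∀ i, T i := hQ.wellFounded.fix fun i ih => f i fun a => ih a.1 ⟨a.2⟩
  have ht : ∀ i, t i = f i fun a => t a.1 := fun i => hQ.wellFounded.fix_eq _ i
  refine ⟨t, fun i => ?_⟩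
  have := hf i fun a => t a.1
  rwa [← ht] at this

end RootedChoice

/-! ### Representations described by vertices and arrows. -/

section QRep

variable {Q : Type u'} [Quiver.{v'} Q] {C : Type u} [Category.{v} C]

/-- The representation given by objects at the vertices and morphisms at the arrows. -/
def repOfArrows (obj : Q → C) (map : ∀ {i j : Q}, (i ⟶ j) → (obj i ⟶ obj j)) : QRep Q C :=
  Paths.lift ⟨obj, map⟩

lemma repMap_repOfArrows (obj : Q → C) (map : ∀ {i j : Q}, (i ⟶ j) → (obj i ⟶ obj j)) {i j : Q}
    (a : i ⟶ j) : repMap (repOfArrows obj map) a = map a :=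
  Paths.lift_toPath _ a

/-- The component of a morphism of representations at a vertex. -/
abbrev repApp {X Y : QRep Q C} (f : X ⟶ Y) (i : Q) : repObj X i ⟶ repObj Y i :=
  f.app ((Paths.of Q).obj i)

lemma repMap_repApp {X Y : QRep Q C} (f : X ⟶ Y) {i j : Q} (a : i ⟶ j) :
    repMap X a ≫ repApp f j = repApp f i ≫ repMap Y a :=
  f.naturality _

/-- A morphism of representations from compatible morphisms at the vertices. -/
def repHomMk {X Y : QRep Q C} (f : ∀ i : Q, repObj X i ⟶ repObj Y i)
    (hf : ∀ {i j : Q} (a : i ⟶ j), repMap X a ≫ f j = f i ≫ repMap Y a) : X ⟶ Y where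
  app i := f i
  naturality i j p := by
    induction p using Paths.induction with
    | id => exact (by simp : X.map (𝟙 _) ≫ f _ = f _ ≫ Y.map (𝟙 _))
    | @comp k l m p a ih =>
      calc X.map (p ≫ (Paths.of Q).map a) ≫ f m
          = X.map p ≫ repMap X a ≫ f m := by rw [Functor.map_comp]; exact Category.assoc _ _ _
        _ = (X.map p ≫ f l) ≫ repMap Y a := by rw [hf a]; exact (Category.assoc _ _ _).symm
        _ = (f k ≫ Y.map p) ≫ repMap Y a := congrArg (· ≫ repMap Y a) ih
        _ = f k ≫ Y.map (p ≫ (Paths.of Q).map a) := by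
          rw [Functor.map_comp]; exact Category.assoc _ _ _

lemma repHom_ext {X Y : QRep Q C} {f g : X ⟶ Y} (h : ∀ i : Q, repApp f i = repApp g i) : f = g :=
  NatTrans.ext (funext h)

lemma ι_phiMap (X : QRep Q C) (i : Q) [HasCoproductsOfShape (ArrowsInto i) C] (a : ArrowsInto i) :
    Limits.Sigma.ι (fun a : ArrowsInto i => repObj X a.1) a ≫ phiMap X i = repMap X a.2 :=
  Limits.Sigma.ι_desc _ _

lemma phiMap_naturality [∀ i : Q, HasCoproductsOfShape (ArrowsInto i) C] {X Y : QRep Q C}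
    (f : X ⟶ Y) (i : Q) :
    Limits.Sigma.map (fun a : ArrowsInto i => repApp f a.1) ≫ phiMap Y i =
      phiMap X i ≫ repApp f i := by
  refine Limits.Sigma.hom_ext _ _ fun a => ?_
  simpa [ι_phiMap, reassoc_of% ι_phiMap X i a] using (repMap_repApp f a.2).symm

lemma mono_of_mono_repApp {X Y : QRep Q C} (f : X ⟶ Y) (h : ∀ i : Q, Mono (repApp f i)) :
    Mono f :=
  have (i : Paths Q) : Mono (f.app i) := h i
  NatTrans.mono_of_mono_app f

lemma epi_of_epi_repApp {X Y : QRep Q C} (f : X ⟶ Y) (h : ∀ i : Q, Epi (repApp f i)) :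
    Epi f :=
  have (i : Paths Q) : Epi (f.app i) := h i
  NatTrans.epi_of_epi_app f

variable [Abelian C]

lemma repApp_comp_eq_zero {X Y Z : QRep Q C} {f : X ⟶ Y} {g : Y ⟶ Z} (w : f ≫ g = 0) (i : Q) :
    repApp f i ≫ repApp g i = 0 := by
  rw [← NatTrans.comp_app, w, zero_app]

lemma shortExact_repApp {X Y Z : QRep Q C} {f : X ⟶ Y} {g : Y ⟶ Z} {w : f ≫ g = 0}
    (hS : (ShortComplex.mk f g w).ShortExact) (i : Q) :
    (ShortComplex.mk (repApp f i) (repApp g i) (repApp_comp_eq_zero w i)).ShortExact :=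
  hS.map_of_exact ((evaluation (Paths Q) C).obj ((Paths.of Q).obj i))

/-- The class of representations all of whose objects lie in a given class. -/
def Pointwise (Q : Type u') [Quiver.{v'} Q] (F : ObjectProperty C) : ObjectProperty (QRep Q C) :=
  fun X => ∀ i : Q, F (repObj X i)

instance (F : ObjectProperty C) [F.IsStableUnderRetracts] :
    (Pointwise Q F).IsStableUnderRetracts where
  of_retract r h i :=
    F.prop_of_retract (r.map ((evaluation (Paths Q) C).obj ((Paths.of Q).obj i))) (h i)

/-- By naturality, φ of a retract is a retract of φ as an arrow. The induced map of coproducts is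
split mono, so exactness of coproducts plays no role. -/
instance [∀ i : Q, HasCoproductsOfShape (ArrowsInto i) C] (F : ObjectProperty C)
    [F.IsStableUnderRetracts] : (Phi Q F).IsStableUnderRetracts where
  of_retract {X Y} r h i := by
    have hr (j : Q) : repApp r.i j ≫ repApp r.r j = 𝟙 _ := by
      rw [← NatTrans.comp_app, r.retract, NatTrans.id_app]
    have hr' : Limits.Sigma.map (fun a : ArrowsInto i => repApp r.i a.1) ≫
        Limits.Sigma.map (fun a : ArrowsInto i => repApp r.r a.1) = 𝟙 _ :=
      Limits.Sigma.hom_ext _ _ fun a => by simp [reassoc_of% hr a.1]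
    have := (h i).1
    constructor
    · have : Mono (phiMap X i ≫ repApp r.i i) := by
        rw [← phiMap_naturality]
        have : Mono (Limits.Sigma.map fun a : ArrowsInto i => repApp r.i a.1) :=
          mono_of_mono_fac hr'
        exact mono_comp _ _
      exact mono_of_mono _ (repApp r.i i)
    · refine F.prop_of_retract (Y := cokernel (phiMap Y i))
        ⟨cokernel.map _ _ _ _ (phiMap_naturality r.i i).symm,
          cokernel.map _ _ _ _ (phiMap_naturality r.r i).symm, ?_⟩ (h i).2
      rw [← cancel_epi (cokernel.π _)]
      simp [reassoc_of% hr i]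

end QRep

/-! ### Extending morphisms and sections. -/

section Extension

variable {C : Type u} [Category.{v} C] [Abelian C]

/-- If `Ext^1(Z, K) = 0`, then morphisms to `K` extend along monomorphisms with cokernel `Z`. -/
lemma exists_extension {X Y Z K : C} {i : X ⟶ Y} {p : Y ⟶ Z} {w : i ≫ p = 0}
    (hS : (ShortComplex.mk i p w).ShortExact) (h : ExtVanishes Z K 1) (d : X ⟶ K) :
    ∃ e : Y ⟶ K, i ≫ e = d := by
  have sq := IsPushout.of_hasPushout i d
  obtain ⟨r, hr⟩ := (extVanishes_one_iff_retraction Z K).1 h _ _ _ _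
    (shortExact_pushout hS sq (sq.inl_desc p 0 (by simp [w])) (sq.inr_desc _ _ _))
  exact ⟨pushout.inl i d ≫ r, by rw [pushout.condition_assoc, hr, Category.comp_id]⟩

/-- If `Ext^1(cokernel m, K) = 0`, then a section over the source of the monomorphism `m` of an
epimorphism with kernel `K` extends to a section. -/
lemma exists_section_extending {K E X U : C} {i : K ⟶ E} {p : E ⟶ X} {w : i ≫ p = 0}
    (hS : (ShortComplex.mk i p w).ShortExact) (m : U ⟶ X) [Mono m]
    (h : ExtVanishes (cokernel m) K 1) (σ : U ⟶ E) (hσ : σ ≫ p = m) :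
    ∃ s : X ⟶ E, s ≫ p = 𝟙 X ∧ m ≫ s = σ := by
  have : Mono i := hS.mono_f
  have : Epi p := hS.epi_g
  -- The map K ⊞ U ⟶ E given by `i` and `σ` is monic with the same cokernel as `m`, so morphisms
  -- from K ⊞ U to `K` extend to `E`.
  have : Mono (biprod.desc i σ) := by
    refine Preadditive.mono_of_cancel_zero _ fun x hx => ?_
    have hx₂ : x ≫ biprod.snd = 0 := by
      rw [← cancel_mono m, zero_comp, ← hσ]
      simpa [biprod.desc_eq, w] using congrArg (· ≫ p) hx
    have hx₁ : x ≫ biprod.fst = 0 := by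
      rw [← cancel_mono i, zero_comp]
      simpa [biprod.desc_eq, reassoc_of% hx₂] using hx
    ext <;> simpa
  have hw : biprod.desc i σ ≫ p ≫ cokernel.π m = 0 := by
    ext
    · simp [reassoc_of% w]
    · simp [reassoc_of% hσ]
  have hT : (ShortComplex.mk _ _ hw).ShortExact := by
    refine shortExact_of_epi_of_factors hw fun k hk => ?_
    obtain ⟨l, rfl⟩ := exists_desc_of_shortExact hS k
      (by simpa using congrArg (biprod.inl ≫ ·) hk)
    have hl : m ≫ l = 0 := by
      rw [← hσ, Category.assoc]
      simpa using congrArg (biprod.inr ≫ ·) hk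
    exact ⟨cokernel.desc m l hl, by simp⟩
  -- The extended projection `r` is a retraction of `i` that kills `σ`; hence `𝟙 E - r ≫ i` descends
  -- along `p` to a section restricting to `σ`.
  obtain ⟨r, hr⟩ := exists_extension hT h biprod.fst
  have hir : i ≫ r = 𝟙 K := by simpa using congrArg (biprod.inl ≫ ·) hr
  have hσr : σ ≫ r = 0 := by simpa using congrArg (biprod.inr ≫ ·) hr
  obtain ⟨s, hs⟩ := exists_desc_of_shortExact hS (𝟙 E - r ≫ i)
    (by simp [reassoc_of% hir])
  refine ⟨s, ?_, ?_⟩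
  · rw [← cancel_epi p, reassoc_of% hs]
    simp [w]
  · rw [← hσ, Category.assoc, hs]
    simp [reassoc_of% hσr]

end Extension

/-! ### Coproducts of short exact sequences. -/

section Coproduct

variable {C : Type u} [Category.{v} C] [Abelian C] {J : Type*} [HasCoproductsOfShape J C]

lemma sigmaMap_comp_eq_zero {X Y Z : J → C} {f : ∀ j, X j ⟶ Y j} {g : ∀ j, Y j ⟶ Z j}
    (w : ∀ j, f j ≫ g j = 0) : Limits.Sigma.map f ≫ Limits.Sigma.map g = 0 :=
  Limits.Sigma.hom_ext _ _ fun j => by simp [reassoc_of% w j]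

/-- Coproducts always preserve cokernels; only monicity on the left has to be assumed. -/
lemma shortExact_sigmaMap {X Y Z : J → C} {f : ∀ j, X j ⟶ Y j} {g : ∀ j, Y j ⟶ Z j}
    {w : ∀ j, f j ≫ g j = 0} (hS : ∀ j, (ShortComplex.mk (f j) (g j) (w j)).ShortExact)
    [Mono (Limits.Sigma.map f)] :
    (ShortComplex.mk (Limits.Sigma.map f) (Limits.Sigma.map g)
      (sigmaMap_comp_eq_zero w)).ShortExact := by
  have hg (j : J) : Epi (g j) := (hS j).epi_g
  refine shortExact_of_epi_of_factors _ fun k hk => ?_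
  have hk' (j : J) : f j ≫ Limits.Sigma.ι Y j ≫ k = 0 := by
    simpa using congrArg (Limits.Sigma.ι X j ≫ ·) hk
  choose l hl using fun j => exists_desc_of_shortExact (hS j) _ (hk' j)
  exact ⟨Limits.Sigma.desc l, Limits.Sigma.hom_ext _ _ fun j => by simp [hl]⟩

end Coproduct

/-! ### The left rooted case. -/

section LeftRooted

variable {Q : Type u'} [Quiver.{v'} Q] {C : Type u} [Category.{v} C] [Abelian C]
  [∀ i : Q, HasCoproductsOfShape (ArrowsInto i) C] {A B : ObjectProperty C}

/-- Over a left rooted quiver, `Ext^1` vanishes between `Φ(𝓐)` and the pointwise `𝓑`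
representations. -/
lemma extVanishes_phi_pointwise (hQ : IsLeftRooted Q)
    (hext : ∀ X Y : C, A X → B Y → ExtVanishes X Y 1) {X Y : QRep Q C} (hX : Phi Q A X)
    (hY : Pointwise Q B Y) : ExtVanishes X Y 1 := by
  rw [extVanishes_one_iff]
  intro E f p w hS
  -- Compatibility with the arrows into `i` says exactly that the section at `i` restricts along
  -- φ_i^X to the one determined at the sources.
  obtain ⟨s, hs⟩ := hQ.exists_choice
    (T := fun i => { s : repObj X i ⟶ repObj E i // s ≫ repApp p i = 𝟙 _ })
    (fun i t s => ∀ a : ArrowsInto i, repMap X a.2 ≫ s.1 = (t a).1 ≫ repMap E a.2) (by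
      intro i t
      have := (hX i).1
      obtain ⟨s, hs, hs'⟩ := exists_section_extending (shortExact_repApp hS i) (phiMap X i)
        (hext _ _ (hX i).2 (hY i)) (Limits.Sigma.desc fun a => (t a).1 ≫ repMap E a.2)
        (Limits.Sigma.hom_ext _ _ fun a => by
          rw [Limits.Sigma.ι_desc_assoc, Category.assoc, repMap_repApp, reassoc_of% (t a).2, ι_phiMap])
      refine ⟨⟨s, hs⟩, fun a => ?_⟩
      simpa [reassoc_of% ι_phiMap X i a] using congrArg (Limits.Sigma.ι _ a ≫ ·) hs')
  exact ⟨repHomMk (fun i => (s i).1) fun {i j} a => hs j ⟨i, a⟩,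
    repHom_ext fun i => (s i).2⟩

/-- At each vertex, factor ⨁ P(s(a)) ⟶ X(i): the monomorphism becomes φ_i of the new representation
and the epimorphism becomes the component of the precover. -/
lemma hasSpecialPrecover_phi_pointwise (hQ : IsLeftRooted Q) (hAB : IsCompleteCotorsionPair A B)
    (X : QRep Q C) : HasSpecialPrecover (Phi Q A) (Pointwise Q B) X := by
  have := hAB.isStableUnderRetracts_right
  obtain ⟨P, hP⟩ := hQ.exists_choice (T := fun i => Over (repObj X i))
    (fun i t P => ∃ u : (∐ fun a => (t a).left) ⟶ P.left,
      u ≫ P.hom = Limits.Sigma.desc (fun a => (t a).hom ≫ repMap X a.2) ∧ Mono u ∧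
        A (cokernel u) ∧ Epi P.hom ∧ B (kernel P.hom)) (by
      intro i t
      obtain ⟨P, u, p, h⟩ := hAB.exists_factorization
        (Limits.Sigma.desc fun a => (t a).hom ≫ repMap X a.2)
      exact ⟨Over.mk p, u, h⟩)
  choose u hu hu_mono hu_coker hP_epi hP_ker using hP
  let R : QRep Q C := repOfArrows (fun i => (P i).left)
    fun {i j} a => Limits.Sigma.ι (fun b : ArrowsInto j => (P b.1).left) ⟨i, a⟩ ≫ u j
  have hR (i : Q) : phiMap R i = u i :=
    Limits.Sigma.hom_ext _ _ fun a => by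
      rw [ι_phiMap]
      exact repMap_repOfArrows _ _ _
  let p : R ⟶ X := repHomMk (fun i => (P i).hom) fun {i j} a => by
    have h := congrArg (Limits.Sigma.ι (fun b : ArrowsInto j => (P b.1).left) ⟨i, a⟩ ≫ ·) (hu j)
    dsimp only at h
    rw [Limits.Sigma.ι_desc, ← Category.assoc] at h
    rw [repMap_repOfArrows]
    exact h
  have : Epi p := epi_of_epi_repApp p hP_epi
  refine ⟨_, R, _, p, _, fun i => ?_, fun i => ?_, shortExact_kernel p⟩
  -- Generalising to `v` allows the equality `hR i` to be substituted inside the cokernel.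
  · have (v : (∐ fun a : ArrowsInto i => (P a.1).left) ⟶ (P i).left) (hv : v = u i) :
        Mono v ∧ A (cokernel v) := by
      subst hv
      exact ⟨hu_mono i, hu_coker i⟩
    exact this _ (hR i)
  · exact B.prop_of_iso (nonempty_kernel_iso_of_shortExact
      (shortExact_repApp (shortExact_kernel p) i)).some.symm (hP_ker i)

/-- The cokernel of a monomorphism of representations `X ⟶ Y` is in `Φ(𝓐)` as soon as, at every
vertex, the morphism from the pushout of `φ^X` to `Y` is a monomorphism with cokernel in `𝓐`. -/
lemma phi_of_shortExact [A.IsStableUnderRetracts] {X Y Z : QRep Q C} {f : X ⟶ Y} {g : Y ⟶ Z}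
    {w : f ≫ g = 0} (hS : (ShortComplex.mk f g w).ShortExact)
    (hmono : ∀ i : Q, Mono (Limits.Sigma.map fun a : ArrowsInto i => repApp f a.1))
    (h : ∀ i : Q, ∃ k : pushout (Limits.Sigma.map fun a : ArrowsInto i => repApp f a.1)
        (phiMap X i) ⟶ repObj Y i,
      pushout.inl _ _ ≫ k = phiMap Y i ∧ pushout.inr _ _ ≫ k = repApp f i ∧ Mono k ∧
        A (cokernel k)) : Phi Q A Z := by
  intro i
  have := hmono i
  obtain ⟨k, hk₁, hk₂, hk_mono, hk_coker⟩ := h i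
  -- Pushed out along φ_i^X, this sequence presents ⨁ Z(s(a)) as the cokernel of X(i) in the
  -- pushout. Composing with `k` then makes the cokernel `N` of X(i) ⟶ Y(i) an extension of
  -- `cokernel k` by ⨁ Z(s(a)).
  have hcoprod := shortExact_sigmaMap fun a : ArrowsInto i => shortExact_repApp hS a.1
  have sq := IsPushout.of_hasPushout
    (Limits.Sigma.map fun a : ArrowsInto i => repApp f a.1) (phiMap X i)
  have hinl := sq.inl_desc (Limits.Sigma.map fun a : ArrowsInto i => repApp g a.1) 0
    (by rw [comp_zero, sigmaMap_comp_eq_zero fun a : ArrowsInto i => repApp_comp_eq_zero w a.1])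
  have hV := shortExact_pushout hcoprod sq hinl (sq.inr_desc _ _ _)
  obtain ⟨N, r, hr, a, b, hab, hN, hN', har, -⟩ := exists_shortExact_comp hV (shortExact_cokernel k)
  have hi := shortExact_repApp hS i
  have := hN.epi_g
  have := hi.epi_g
  have := hcoprod.epi_g
  obtain ⟨e, he⟩ := exists_desc_of_shortExact hN (repApp g i)
    (by rw [hk₂, repApp_comp_eq_zero w])
  obtain ⟨e', he'⟩ := exists_desc_of_shortExact hi r (by rw [← hk₂]; exact hr)
  -- Under the identification `e` of `N` with Z(i), φ_i^Z is the inclusion `a`, so its cokernel is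
  -- that of `k`.
  have hφ : phiMap Z i = a ≫ e := by
    rw [← cancel_epi (Limits.Sigma.map fun a : ArrowsInto i => repApp g a.1), phiMap_naturality,
      ← hk₁, ← hinl, Category.assoc, Category.assoc, ← reassoc_of% har, he]
  have : IsIso e := ⟨e', by rw [← cancel_epi r, reassoc_of% he, he', Category.comp_id],
    by rw [← cancel_epi (repApp g i), reassoc_of% he', he, Category.comp_id]⟩
  have : Mono a := hN'.mono_f
  have hφ_mono : Mono (a ≫ e) := mono_comp _ _
  have hφ_coker : A (cokernel (a ≫ e)) := A.prop_of_iso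
    ((nonempty_cokernel_iso_of_shortExact hN').some ≪≫ (cokernelCompIsIso a e).symm) hk_coker
  simpa only [hφ] using And.intro hφ_mono hφ_coker

/-- The new value at `i` must receive X(i) and the values at the sources compatibly, so it is a
special preenvelope of their pushout. -/
lemma hasSpecialPreenvelope_phi_pointwise
    [∀ i : Q, (MorphismProperty.monomorphisms C).IsStableUnderCoproductsOfShape (ArrowsInto i)]
    (hQ : IsLeftRooted Q) (hAB : IsCompleteCotorsionPair A B) (X : QRep Q C) :
    HasSpecialPreenvelope (Phi Q A) (Pointwise Q B) X := by
  have := hAB.isStableUnderRetracts_left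
  obtain ⟨Y, hY⟩ := hQ.exists_choice (T := fun i => Under (repObj X i))
    (fun i t Y => ∃ k : pushout (Limits.Sigma.map fun a => (t a).hom) (phiMap X i) ⟶ Y.right,
      pushout.inr _ _ ≫ k = Y.hom ∧ Mono k ∧ A (cokernel k) ∧ B Y.right) (by
      intro i t
      obtain ⟨E, L, k, c, w, hL, hE, hS⟩ := hAB.enoughInjectives
        (pushout (Limits.Sigma.map fun a => (t a).hom) (phiMap X i))
      exact ⟨Under.mk (pushout.inr _ _ ≫ k), k, rfl, hS.mono_f,
        A.prop_of_iso (nonempty_cokernel_iso_of_shortExact hS).some hL, hE⟩)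
  choose k hk hk_mono hk_coker hYB using hY
  let R : QRep Q C := repOfArrows (fun i => (Y i).right) fun {i j} a =>
    Limits.Sigma.ι (fun b : ArrowsInto j => (Y b.1).right) ⟨i, a⟩ ≫ pushout.inl _ _ ≫ k j
  have hR (i : Q) : phiMap R i = pushout.inl _ _ ≫ k i :=
    Limits.Sigma.hom_ext _ _ fun a => by
      rw [ι_phiMap]
      exact repMap_repOfArrows _ _ _
  let f : X ⟶ R := repHomMk (fun i => (Y i).hom) fun {i j} a => by
    have h := congrArg (Limits.Sigma.ι (fun b : ArrowsInto j => repObj X b.1) ⟨i, a⟩ ≫ · ≫ k j)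
      (pushout.condition (f := Limits.Sigma.map fun b : ArrowsInto j => (Y b.1).hom)
        (g := phiMap X j))
    dsimp only at h
    rw [Category.assoc, Limits.Sigma.ι_map_assoc, Category.assoc, hk,
      reassoc_of% ι_phiMap X j ⟨i, a⟩] at h
    rw [repMap_repOfArrows]
    exact h.symm
  -- Induction along arrows: a coproduct of monomorphisms is monic, and so is its pushout X(i) ⟶
  -- pushout.
  have hf (i : Q) : Mono (repApp f i) := by
    induction i using hQ.wellFounded.induction with
    | _ i ih =>
      have (a : ArrowsInto i) : Mono (Y a.1).hom := ih a.1 ⟨a.2⟩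
      have := hk_mono i
      have := mono_comp (pushout.inr _ _) (k i)
      rwa [hk i] at this
  have : Mono f := mono_of_mono_repApp f hf
  refine ⟨R, _, f, _, _, ?_, hYB, shortExact_cokernel f⟩
  exact phi_of_shortExact (shortExact_cokernel f) (fun i => inferInstance)
    fun i => ⟨k i, (hR i).symm, hk i, hk_mono i, hk_coker i⟩

/-- Over a left rooted quiver, a complete cotorsion pair `(𝓐, 𝓑)`, hereditary or not, induces the
complete cotorsion pair formed by `Φ(𝓐)` and the pointwise `𝓑` representations. -/
theorem isCompleteCotorsionPair_phi_pointwise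
    [∀ i : Q, (MorphismProperty.monomorphisms C).IsStableUnderCoproductsOfShape (ArrowsInto i)]
    (hQ : IsLeftRooted Q) (hAB : IsCompleteCotorsionPair A B) :
    IsCompleteCotorsionPair (Phi Q A) (Pointwise Q B) :=
  have := hAB.isStableUnderRetracts_left
  have := hAB.isStableUnderRetracts_right
  .mk' (fun _ _ => extVanishes_phi_pointwise hQ fun _ _ => hAB.extVanishes)
    (hasSpecialPrecover_phi_pointwise hQ hAB) (hasSpecialPreenvelope_phi_pointwise hQ hAB)

end LeftRooted

open Opposite

/-! ### Cotorsion pairs under opposites and equivalences. -/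

section Duality

universe v₁ u₁ v₂ u₂

variable {C : Type u₁} [Category.{v₁} C] [Abelian C]

/-- Passing to opposites exchanges sections and retractions of an extension. -/
lemma ExtVanishes.op {X Y : C} (h : ExtVanishes X Y 1) : ExtVanishes (op Y) (op X) 1 := by
  rw [extVanishes_one_iff]
  rw [extVanishes_one_iff_retraction] at h
  intro E i p w hS
  obtain ⟨r, hr⟩ := h E.unop p.unop i.unop (by rw [← unop_comp, w, unop_zero]) hS.unop
  exact ⟨r.op, Quiver.Hom.unop_inj hr⟩

lemma IsCompleteCotorsionPair.op {A B : ObjectProperty C} (h : IsCompleteCotorsionPair A B) :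
    IsCompleteCotorsionPair B.op A.op :=
  have := h.isStableUnderRetracts_left
  have := h.isStableUnderRetracts_right
  have : A.op.IsStableUnderRetracts :=
    ⟨fun r => A.prop_of_retract ⟨r.r.unop, r.i.unop, Quiver.Hom.op_inj r.retract⟩⟩
  have : B.op.IsStableUnderRetracts :=
    ⟨fun r => B.prop_of_retract ⟨r.r.unop, r.i.unop, Quiver.Hom.op_inj r.retract⟩⟩
  .mk' (fun X Y hX hY => (h.extVanishes hY hX).op)
    (fun X => by
      obtain ⟨E, L, i, p, w, hL, hE, hS⟩ := h.enoughInjectives X.unop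
      exact ⟨_, _, p.op, i.op, by rw [← op_comp, w, op_zero], hE, hL, hS.op⟩)
    (fun X => by
      obtain ⟨K, P, i, p, w, hP, hK, hS⟩ := h.enoughProjectives X.unop
      exact ⟨_, _, p.op, i.op, by rw [← op_comp, w, op_zero], hK, hP, hS.op⟩)

variable {D : Type u₂} [Category.{v₂} D] [Abelian D]

lemma ExtVanishes.of_equivalence (E : C ≌ D) {X Y : C}
    (h : ExtVanishes (E.functor.obj X) (E.functor.obj Y) 1) : ExtVanishes X Y 1 := by
  rw [extVanishes_one_iff] at h ⊢
  intro M i p w hS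
  obtain ⟨s, hs⟩ := h _ _ _ _ (hS.map_of_exact E.functor)
  obtain ⟨s, rfl⟩ := E.functor.map_surjective s
  exact ⟨s, E.functor.map_injective (by rw [E.functor.map_comp, E.functor.map_id]; exact hs)⟩

/-- Complete cotorsion pairs can be pulled back along equivalences of categories. -/
lemma IsCompleteCotorsionPair.of_equivalence {A B : ObjectProperty D}
    (h : IsCompleteCotorsionPair A B) (E : C ≌ D) :
    IsCompleteCotorsionPair (A.inverseImage E.functor) (B.inverseImage E.functor) :=
  have := h.isStableUnderRetracts_left
  have := h.isStableUnderRetracts_right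
  have : (A.inverseImage E.functor).IsStableUnderRetracts :=
    ⟨fun r => A.prop_of_retract (r.map E.functor)⟩
  have : (B.inverseImage E.functor).IsStableUnderRetracts :=
    ⟨fun r => B.prop_of_retract (r.map E.functor)⟩
  .mk' (fun X Y hX hY => .of_equivalence E (h.extVanishes hX hY))
    (fun X => by
      obtain ⟨K, P, i, p, w, hP, hK, hS⟩ := h.enoughProjectives (E.functor.obj X)
      have w' : E.inverse.map i ≫ E.inverse.map p = 0 := by
        rw [← E.inverse.map_comp, w, E.inverse.map_zero]
      refine ⟨_, _, E.inverse.map i, E.inverse.map p ≫ E.unitInv.app X,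
        by rw [reassoc_of% w', zero_comp], A.prop_of_iso (E.counitIso.symm.app P) hP,
        B.prop_of_iso (E.counitIso.symm.app K) hK,
        ShortComplex.shortExact_of_iso ?_ (hS.map_of_exact E.inverse)⟩
      exact ShortComplex.isoMk (Iso.refl _) (Iso.refl _) (E.unitIso.symm.app X)
        ((Category.id_comp _).trans (Category.comp_id _).symm) (Category.id_comp _))
    (fun X => by
      obtain ⟨M, L, i, p, w, hL, hM, hS⟩ := h.enoughInjectives (E.functor.obj X)
      have w' : E.inverse.map i ≫ E.inverse.map p = 0 := by
        rw [← E.inverse.map_comp, w, E.inverse.map_zero]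
      refine ⟨_, _, E.unit.app X ≫ E.inverse.map i, E.inverse.map p,
        by rw [Category.assoc, w', comp_zero], A.prop_of_iso (E.counitIso.symm.app L) hL,
        B.prop_of_iso (E.counitIso.symm.app M) hM,
        ShortComplex.shortExact_of_iso ?_ (hS.map_of_exact E.inverse)⟩
      exact ShortComplex.isoMk (E.unitIso.symm.app X) (Iso.refl _) (Iso.refl _)
        ((E.unitIso.inv_hom_id_app_assoc X _).trans (Category.comp_id _).symm)
        ((Category.id_comp _).trans (Category.comp_id _).symm))

lemma IsCompleteCotorsionPair.unop {A B : ObjectProperty Cᵒᵖ} (h : IsCompleteCotorsionPair A B) :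
    IsCompleteCotorsionPair B.unop A.unop :=
  h.op.of_equivalence (opOpEquivalence C).symm

end Duality

section OpKernel

variable {C : Type u} [Category.{v} C] [Abelian C]

lemma mono_iso_comp_op_and_cokernel_iff (B : ObjectProperty C) [B.IsClosedUnderIsomorphisms]
    {X Y : C} (f : X ⟶ Y) {U : Cᵒᵖ} (e : U ≅ op Y) :
    Mono (e.hom ≫ f.op) ∧ B.op (cokernel (e.hom ≫ f.op)) ↔ Epi f ∧ B (kernel f) := by
  refine and_congr ?_ (B.op.prop_iff_of_iso (cokernelEpiComp e.hom f.op ≪≫ cokernelOpOp f))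
  rw [← op_mono_iff]
  exact (MorphismProperty.monomorphisms Cᵒᵖ).cancel_left_of_respectsIso e.hom f.op

end OpKernel

/-! ### Opposite representations: Ψ as the dual of Φ. -/

section Opposite

variable {Q : Type u'} [Quiver.{v'} Q] {C : Type u} [Category.{v} C]

variable (Q C) in
/-- The opposite of a representation, as a representation of the opposite quiver. -/
def repOp : (QRep Q C)ᵒᵖ ⥤ QRep Qᵒᵖ Cᵒᵖ where
  obj X := repOfArrows (fun i => op (repObj X.unop i.unop)) fun a => (repMap X.unop a.unop).op
  map f := repHomMk (fun i => (repApp f.unop i.unop).op) fun a => by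
    rw [repMap_repOfArrows, repMap_repOfArrows]
    exact (congrArg Quiver.Hom.op (repMap_repApp f.unop a.unop)).symm

instance : (repOp Q C).Faithful where
  map_injective h := Quiver.Hom.unop_inj (repHom_ext fun i =>
    Quiver.Hom.op_inj (congrArg (repApp · (op i)) h))

instance : (repOp Q C).Full where
  map_surjective {X Y} f := ⟨(repHomMk (fun i => (repApp f (op i)).unop) fun {i j} a => by
    have h := repMap_repApp f a.op
    erw [repMap_repOfArrows, repMap_repOfArrows] at h
    exact (congrArg Quiver.Hom.unop h).symm).op, rfl⟩

/-- Agreement on arrows suffices for an isomorphism with identity components. -/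
instance : (repOp Q C).EssSurj where
  mem_essImage Y := by
    let X : QRep Q C := repOfArrows (fun i => (repObj Y (op i)).unop) fun a => (repMap Y a.op).unop
    have h {i j : Qᵒᵖ} (a : i ⟶ j) : repMap ((repOp Q C).obj (op X)) a = repMap Y a :=
      (repMap_repOfArrows _ _ a).trans (congrArg Quiver.Hom.op (repMap_repOfArrows _ _ a.unop))
    exact ⟨op X, ⟨{
      hom := repHomMk (fun i => 𝟙 (repObj Y i)) fun a =>
        (Category.comp_id _).trans ((h a).trans (Category.id_comp _).symm)
      inv := repHomMk (fun i => 𝟙 (repObj Y i)) fun a =>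
        (Category.comp_id _).trans ((h a).symm.trans (Category.id_comp _).symm)
      hom_inv_id := repHom_ext fun i => Category.comp_id (𝟙 (repObj Y i))
      inv_hom_id := repHom_ext fun i => Category.comp_id (𝟙 (repObj Y i)) }⟩⟩

instance : (repOp Q C).IsEquivalence where

/-- The arrows out of a vertex, as arrows into the corresponding vertex of the opposite quiver. -/
def arrowsIntoOpEquiv (i : Q) : ArrowsInto (op i) ≃ ArrowsOutOf i where
  toFun a := ⟨a.1.unop, a.2.unop⟩
  invFun a := ⟨op a.1, a.2.op⟩
  left_inv _ := rfl
  right_inv _ := rfl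

variable [∀ i : Q, HasProductsOfShape (ArrowsOutOf i) C]

instance (i : Qᵒᵖ) : HasCoproductsOfShape (ArrowsInto i) Cᵒᵖ :=
  have : HasCoproductsOfShape (ArrowsOutOf i.unop) Cᵒᵖ := hasCoproductsOfShape_opposite _
  hasColimitsOfShape_of_equivalence (Discrete.equivalence (arrowsIntoOpEquiv i.unop).symm)

/-- The source of `φ` for the opposite representation is the opposite of the target of `ψ`. -/
def coproductRepOpIso (X : QRep Q C) (i : Q) :
    (∐ fun a : ArrowsInto (op i) => repObj ((repOp Q C).obj (op X)) a.1) ≅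
      op (∏ᶜ fun a : ArrowsOutOf i => repObj X a.1) :=
  have : HasCoproductsOfShape (ArrowsOutOf i) Cᵒᵖ := hasCoproductsOfShape_opposite _
  Sigma.reindex (arrowsIntoOpEquiv i) (fun a => op (repObj X a.1)) ≪≫
    (opProductIsoCoproduct fun a : ArrowsOutOf i => repObj X a.1).symm

lemma phiMap_repOp (X : QRep Q C) (i : Q) :
    phiMap ((repOp Q C).obj (op X)) (op i) = (coproductRepOpIso X i).hom ≫ (psiMap X i).op := by
  refine Limits.Sigma.hom_ext _ _ fun a => ?_
  have : HasCoproductsOfShape (ArrowsOutOf i) Cᵒᵖ := hasCoproductsOfShape_opposite _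
  have h : Limits.Sigma.ι (fun a : ArrowsInto (op i) => repObj ((repOp Q C).obj (op X)) a.1) a ≫
      (coproductRepOpIso X i).hom =
        (Pi.π (fun a : ArrowsOutOf i => repObj X a.1) (arrowsIntoOpEquiv i a)).op := by
    have h₁ := Sigma.ι_reindex_hom (arrowsIntoOpEquiv i) (fun a => op (repObj X a.1)) a
    have h₂ := π_comp_opProductIsoCoproduct_hom (fun a : ArrowsOutOf i => repObj X a.1)
      (arrowsIntoOpEquiv i a)
    rw [← Iso.eq_comp_inv] at h₂
    exact (Category.assoc _ _ _).symm.trans ((congrArg (· ≫ _) h₁).trans h₂.symm)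
  have h' : (Pi.π (fun a : ArrowsOutOf i => repObj X a.1) (arrowsIntoOpEquiv i a)).op ≫
      (psiMap X i).op = (repMap X a.2.unop).op := by
    rw [← op_comp, psiMap, Pi.lift_π]
    rfl
  exact (ι_phiMap _ _ a).trans ((repMap_repOfArrows _ _ a.2).trans
    (h'.symm.trans ((congrArg (· ≫ (psiMap X i).op) h).symm.trans (Category.assoc _ _ _))))

variable [Abelian C]

lemma phi_repOp_iff (B : ObjectProperty C) [B.IsClosedUnderIsomorphisms] (X : QRep Q C) :
    Phi Qᵒᵖ B.op ((repOp Q C).obj (op X)) ↔ Psi Q B X := by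
  have h (i : Q) : (Mono (phiMap ((repOp Q C).obj (op X)) (op i)) ∧
      B.op (cokernel (phiMap ((repOp Q C).obj (op X)) (op i)))) ↔
        Epi (psiMap X i) ∧ B (kernel (psiMap X i)) := by
    rw [← mono_iso_comp_op_and_cokernel_iff B (psiMap X i) (coproductRepOpIso X i)]
    simp only [phiMap_repOp X i]
    rfl
  exact ⟨fun hX i => (h i).1 (hX (op i)), fun hX i => (h i.unop).2 (hX i.unop)⟩

end Opposite

/-! ### Exact products give exact coproducts in the opposite category. -/

section ExactProducts

variable {C : Type u} [Category.{v} C] [Abelian C] (J : Type*) [HasProductsOfShape J C]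
  [HasExactLimitsOfShape (Discrete J) C]

lemma epi_piMap {X Y : J → C} (g : ∀ j, X j ⟶ Y j) [∀ j, Epi (g j)] : Epi (Limits.Pi.map g) := by
  let α : Discrete.functor X ⟶ Discrete.functor Y := Discrete.natTrans fun j => g j.as
  have (j : Discrete J) : Epi (α.app j) := inferInstanceAs (Epi (g j.as))
  have := NatTrans.epi_of_epi_app α
  exact inferInstanceAs (Epi (lim.map α))

/-- A coproduct of maps in `Cᵒᵖ` is, up to isomorphism, the opposite of a product of maps in `C`,
which is epi when its factors are. -/
lemma isStableUnderCoproductsOfShape_monomorphisms_op :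
    (MorphismProperty.monomorphisms Cᵒᵖ).IsStableUnderCoproductsOfShape J := by
  refine .mk _ J fun X Y _ _ f (hf : ∀ j, Mono (f j)) => ?_
  have := epi_piMap J fun j => (f j).unop
  have h : Limits.Sigma.map f = (opProductIsoCoproduct fun j => (X j).unop).inv ≫
      (Limits.Pi.map fun j => (f j).unop).op ≫
        (opProductIsoCoproduct fun j => (Y j).unop).hom := by
    refine Limits.Sigma.hom_ext _ _ fun j => ?_
    have h₁ := π_comp_opProductIsoCoproduct_hom (fun j => (X j).unop) j
    have h₂ := π_comp_opProductIsoCoproduct_hom (fun j => (Y j).unop) j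
    rw [← Iso.eq_comp_inv] at h₁
    have h₃ : (Pi.π (fun j => (X j).unop) j).op ≫ (Limits.Pi.map fun j => (f j).unop).op =
        f j ≫ (Pi.π (fun j => (Y j).unop) j).op := by
      rw [← op_comp, Pi.map_π]
      rfl
    rw [Limits.Sigma.ι_map]
    refine Eq.trans ?_ (congrArg (· ≫ _) h₁ |>.trans (Category.assoc _ _ _))
    rw [reassoc_of% h₃, h₂]
  rw [h, MorphismProperty.monomorphisms.iff]
  infer_instance

end ExactProducts

/-! ### The right rooted case, and the theorem. -/

section RightRooted

variable {Q : Type u'} [Quiver.{v'} Q] {C : Type u} [Category.{v} C] [Abelian C]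
  [∀ i : Q, HasProductsOfShape (ArrowsOutOf i) C]
  [∀ i : Q, HasExactLimitsOfShape (Discrete (ArrowsOutOf i)) C] {A B : ObjectProperty C}

theorem isCompleteCotorsionPair_psi (hQ : IsRightRooted Q) (hAB : IsCompleteCotorsionPair A B) :
    IsCompleteCotorsionPair (leftPerp (Psi Q B)) (Psi Q B) := by
  have (i : Qᵒᵖ) : (MorphismProperty.monomorphisms Cᵒᵖ).IsStableUnderCoproductsOfShape
      (ArrowsInto i) := by
    let e := Discrete.equivalence (arrowsIntoOpEquiv i.unop).symm
    have := HasExactLimitsOfShape.of_domain_equivalence C e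
    have := hasLimitsOfShape_of_equivalence (C := C) e
    exact isStableUnderCoproductsOfShape_monomorphisms_op _
  have := hAB.isStableUnderRetracts_right
  have h := ((isCompleteCotorsionPair_phi_pointwise hQ hAB.op).of_equivalence
    (repOp Q C).asEquivalence).unop
  have hB : ((Phi Qᵒᵖ B.op).inverseImage (repOp Q C).asEquivalence.functor).unop = Psi Q B :=
    funext fun X => propext (phi_repOp_iff B X)
  rw [hB] at h
  rwa [h.leftPerp_eq]

end RightRooted

end QuiverCotorsion

end

theorem theorem4 {C : Type u} [Category.{v} C] [Abelian C] {Q : Type u'} [Quiver.{v'} Q]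
    (A B : ObjectProperty C)
    (hAB : QuiverCotorsion.IsCompleteCotorsionPair A B)
    (hher : QuiverCotorsion.IsHereditary A B) :
    (∀ [∀ i : Q, HasCoproductsOfShape (QuiverCotorsion.ArrowsInto i) C]
      [∀ i : Q, HasExactColimitsOfShape (Discrete (QuiverCotorsion.ArrowsInto i)) C],
      QuiverCotorsion.IsLeftRooted Q →
        QuiverCotorsion.IsCompleteCotorsionPair
          (QuiverCotorsion.Phi Q A)
          (QuiverCotorsion.rightPerp (QuiverCotorsion.Phi Q A))) ∧
    (∀ [∀ i : Q, HasProductsOfShape (QuiverCotorsion.ArrowsOutOf i) C]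
      [∀ i : Q, HasExactLimitsOfShape (Discrete (QuiverCotorsion.ArrowsOutOf i)) C],
      QuiverCotorsion.IsRightRooted Q →
        QuiverCotorsion.IsCompleteCotorsionPair
          (QuiverCotorsion.leftPerp (QuiverCotorsion.Psi Q B))
          (QuiverCotorsion.Psi Q B)) := by
  refine ⟨fun hQ => ?_, fun hQ => QuiverCotorsion.isCompleteCotorsionPair_psi hQ hAB⟩
  -- Exactness of the coproducts enters as stability of monomorphisms under them; `h` itself
  -- identifies Φ(𝓐)^⊥ with the pointwise class.
  have h := QuiverCotorsion.isCompleteCotorsionPair_phi_pointwise hQ hAB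
  rwa [h.rightPerp_eq]
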